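/- Work over $\mathbb{C}$. Let $V$ be a simple vertex algebra of countable dimension, let $G$ be a finite group of automorphisms of $V$, and let $V^G=\{v\in V : gv=v \text{ for all } g\in G\}$ be the vertex subalgebra of fixed points. Let $\sigma$ be a central element of $G$, of order $T$, and write $V^r=\{v\in V : \sigma v=e^{-2\pi i r/T}v\}$ for $0\le r<T$. A $\sigma$-twisted $V$-module is a vector space $M$ with a linear map $v\mapsto Y_M(v,z)=\sum_{n\in\frac1T\mathbb{Z}}v_nz^{-n-1}$, $v_n\in\mathrm{End}(M)$, such that for all $u\in V^r$, $v\in V$, $w\in M$: $u_n=0$ unless $n\in\frac rT+\mathbb{Z}$; $u_nw=0$ for $n$ sufficiently large; $Y_M(\mathbf 1,z)=\mathrm{Id}_M$; and $$z_0^{-1}\delta\Big(\frac{z_1-z_2}{z_0}\Big)Y_M(u,z_1)Y_M(v,z_2)-z_0^{-1}\delta\Big(\frac{z_2-z_1}{-z_0}\Big)Y_M(v,z_2)Y_M(u,z_1)=z_2^{-1}\Big(\frac{z_1-z_0}{z_2}\Big)^{-r/T}\delta\Big(\frac{z_1-z_0}{z_2}\Big)Y_M(Y(u,z_0)v,z_2).$$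 It is irreducible if it is nonzero and no subspace besides $0$ and $M$ is stable under all $v_n$, $v\in V$. For $h\in G$ let $M\cdot h$ be the $\sigma$-twisted $V$-module with underlying space $M$ and $Y_{M\cdot h}(v,z)=Y_M(hv,z)$. Let $M$ be an irreducible $\sigma$-twisted $V$-module, and let $G_M=\{h\in G : M\cdot h\cong M \text{ as } \sigma\text{-twisted } V\text{-modules}\}$ be its stabilizer. Then $M$, regarded as a $V^G$-module by restricting $Y_M$ to $V^G$, is irreducible if and only if $G_M=\{1\}$. -/

import Mathlib

/-- A vertex algebra over `ℂ`, given by the modes `u_n` of `Y(u,z) = ∑ u_n z^{-n-1}`, where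
`mode n u v` is `u_n v`.  The field `jacobi` is the Jacobi identity applied to `w`: it is the equality
of the coefficients of `z₀^{-l-1} z₁^{-m-1} z₂^{-n-1}` of its two sides.  By `truncation` all sums
over `i` have finite support. -/
class VertexAlgebra (V : Type*) [AddCommGroup V] [Module ℂ V] where
  /-- `mode n u v = u_n v` -/
  mode : ℤ → V →ₗ[ℂ] V →ₗ[ℂ] V
  /-- the vacuum vector -/
  vac : V
  truncation : ∀ u v : V, ∃ N : ℤ, ∀ n : ℤ, N ≤ n → mode n u v = 0
  vac_mode : ∀ (n : ℤ) (v : V), mode n vac v = if n = -1 then v else 0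
  mode_vac_of_nonneg : ∀ (v : V) (n : ℤ), 0 ≤ n → mode n v vac = 0
  mode_neg_one_vac : ∀ v : V, mode (-1) v vac = v
  jacobi : ∀ (u v w : V) (l m n : ℤ),
    (∑ᶠ i : ℕ, ((-1 : ℂ) ^ i * (Ring.choose l i : ℤ)) • mode (m + l - i) u (mode (n + i) v w))
      - (∑ᶠ i : ℕ, ((-1 : ℂ) ^ l * (-1 : ℂ) ^ i * (Ring.choose l i : ℤ)) •
          mode (n + l - i) v (mode (m + i) u w))
      = ∑ᶠ i : ℕ, ((Ring.choose m i : ℤ) : ℂ) • mode (m + n - i) (mode (l + i) u v) w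

namespace VertexAlgebra

section Basic

variable (V : Type*) [AddCommGroup V] [Module ℂ V] [VertexAlgebra V]

variable {V} in
/-- An ideal of a vertex algebra: `u_n a ∈ I` and `a_n u ∈ I` for all `a ∈ I`, `u ∈ V`, `n ∈ ℤ`. -/
def IsIdeal (I : Submodule ℂ V) : Prop :=
  ∀ (u : V) (n : ℤ), ∀ a ∈ I, mode n u a ∈ I ∧ mode n a u ∈ I

/-- A vertex algebra is simple if it is nonzero and has no ideals besides `0` and itself. -/
def IsSimple : Prop :=
  Nontrivial V ∧ ∀ I : Submodule ℂ V, IsIdeal I → I = ⊥ ∨ I = ⊤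

/-- The automorphism group of a vertex algebra, as a subgroup of the group of linear automorphisms. -/
def autSubgroup : Subgroup (V ≃ₗ[ℂ] V) where
  carrier := {g | g vac = vac ∧ ∀ (u v : V) (n : ℤ), g (mode n u v) = mode n (g u) (g v)}
  one_mem' := ⟨rfl, fun _ _ _ => rfl⟩
  mul_mem' := by
    rintro a b ⟨ha, ha'⟩ ⟨hb, hb'⟩
    refine ⟨?_, fun u v n => ?_⟩
    · rw [LinearEquiv.mul_apply, hb, ha]
    · simp only [LinearEquiv.mul_apply, hb', ha']
  inv_mem' := by
    rintro a ⟨ha, ha'⟩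
    refine ⟨?_, fun u v n => ?_⟩
    · change a.symm vac = vac
      rw [LinearEquiv.symm_apply_eq, ha]
    · change a.symm _ = mode n (a.symm u) (a.symm v)
      rw [LinearEquiv.symm_apply_eq, ha']
      simp

/-- The group `Aut(V)`; it acts on `V`, and the action is written `g • v`. -/
abbrev Aut : Type _ := ↥(autSubgroup V)

variable {V}

theorem Aut.smul_vac (g : Aut V) : g • (vac : V) = vac := g.2.1

theorem Aut.smul_mode (g : Aut V) (u v : V) (n : ℤ) :
    g • (mode n u v) = mode n (g • u) (g • v) := g.2.2 u v n

/-- The subspace `V^G` of fixed points of a group `G` of automorphisms of `V`. -/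
def fixedPoints (G : Subgroup (Aut V)) : Submodule ℂ V where
  carrier := {v | ∀ g ∈ G, g • v = v}
  zero_mem' := fun g _ => smul_zero g
  add_mem' := fun {a b} ha hb g hg => by rw [smul_add, ha g hg, hb g hg]
  smul_mem' := fun c x hx g hg => by
    have h : g • (c • x) = c • (g • x) := map_smul (g : V ≃ₗ[ℂ] V) c x
    rw [h, hx g hg]

theorem mode_mem_fixedPoints (G : Subgroup (Aut V)) (n : ℤ) {u v : V}
    (hu : u ∈ fixedPoints G) (hv : v ∈ fixedPoints G) : mode n u v ∈ fixedPoints G :=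
  fun g hg => by rw [Aut.smul_mode, hu g hg, hv g hg]

theorem coe_finsum_smul {E : Type*} [AddCommGroup E] [Module ℂ E] (S : Submodule ℂ E)
    (c : ℕ → ℂ) (f : ℕ → S) :
    ((∑ᶠ i, c i • f i : S) : E) = ∑ᶠ i, c i • (f i : E) :=
  AddMonoidHom.map_finsum_of_injective S.subtype.toAddMonoidHom S.subtype_injective _

/-- `V^G` is a vertex algebra, with the operations of `V`. -/
instance fixedPointsVertexAlgebra (G : Subgroup (Aut V)) : VertexAlgebra (fixedPoints G) where
  mode n := LinearMap.mk₂ ℂ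
    (fun u v => (⟨mode n (u : V) (v : V), mode_mem_fixedPoints G n u.2 v.2⟩ : fixedPoints G))
    (fun _ _ _ => Subtype.ext (by simp)) (fun _ _ _ => Subtype.ext (by simp))
    (fun _ _ _ => Subtype.ext (by simp)) (fun _ _ _ => Subtype.ext (by simp))
  vac := ⟨vac, fun g _ => Aut.smul_vac g⟩
  truncation u v := by
    obtain ⟨N, hN⟩ := truncation (u : V) (v : V)
    exact ⟨N, fun n hn => Subtype.ext (hN n hn)⟩
  vac_mode n v := by
    apply Subtype.ext
    change mode n (vac : V) (v : V) = _
    rw [vac_mode]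
    split_ifs <;> rfl
  mode_vac_of_nonneg v n hn := Subtype.ext (mode_vac_of_nonneg (v : V) n hn)
  mode_neg_one_vac v := Subtype.ext (mode_neg_one_vac (v : V))
  jacobi u v w l m n := by
    apply Subtype.ext
    rw [Submodule.coe_sub, coe_finsum_smul, coe_finsum_smul, coe_finsum_smul]
    exact jacobi (u : V) (v : V) (w : V) l m n

/-- The eigenspace `V^r` of `g` with eigenvalue `e^{-2πir/T}`, where `T` is the order of `g`. -/
def eigenspace (g : Aut V) (r : ℕ) : Set V :=
  {v | g • v = Complex.exp (-2 * Real.pi * Complex.I * r / orderOf g) • v}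

end Basic

/-- The structure of a `g`-twisted `V`-module on a vector space `M`, for an automorphism `g` of finite
order `T`, given by the modes `v_n` of `Y_M(v,z) = ∑ v_n z^{-n-1}`, where `mode n v w` is `v_n w`.
The index `n` is rational; by `mode_eq_zero` only the modes with `n ∈ (1/T)ℤ` can be nonzero.
The field `jacobi` is the twisted Jacobi identity applied to `w`: it is the equality of the
coefficients of `z₀^{-l-1} z₁^{-m-1} z₂^{-n-1}` of its two sides, where `m ∈ r/T + ℤ`, since for
`u ∈ V^r` no other powers of `z₁` occur.  By `truncation` all sums over `i` have finite support. -/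
structure TwistedModule {V : Type*} [AddCommGroup V] [Module ℂ V] [VertexAlgebra V] (g : Aut V)
    (M : Type*) [AddCommGroup M] [Module ℂ M] where
  isOfFinOrder : IsOfFinOrder g
  /-- `mode n v w = v_n w` -/
  mode : ℚ → V →ₗ[ℂ] M →ₗ[ℂ] M
  mode_eq_zero : ∀ r < orderOf g, ∀ u ∈ eigenspace g r, ∀ n : ℚ,
    (¬ ∃ k : ℤ, n = (r : ℚ) / orderOf g + k) → mode n u = 0
  truncation : ∀ (u : V) (w : M), ∃ N : ℚ, ∀ n : ℚ, N ≤ n → mode n u w = 0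
  vac_mode : ∀ (n : ℚ) (w : M), mode n vac w = if n = -1 then w else 0
  jacobi : ∀ r < orderOf g, ∀ u ∈ eigenspace g r, ∀ (v : V) (w : M) (l : ℤ) (m n : ℚ),
    (∃ k : ℤ, m = (r : ℚ) / orderOf g + k) →
    (∑ᶠ i : ℕ, ((-1 : ℂ) ^ i * (Ring.choose l i : ℤ)) • mode (m + l - i) u (mode (n + i) v w))
      - (∑ᶠ i : ℕ, ((-1 : ℂ) ^ l * (-1 : ℂ) ^ i * (Ring.choose l i : ℤ)) •
          mode (n + l - i) v (mode (m + i) u w))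
      = ∑ᶠ i : ℕ, ((Ring.choose m i : ℚ) : ℂ) • mode (m + n - i) (VertexAlgebra.mode (l + i) u v) w

/-- A `V`-module is a `1`-twisted `V`-module. -/
abbrev VModule (V : Type*) [AddCommGroup V] [Module ℂ V] [VertexAlgebra V]
    (M : Type*) [AddCommGroup M] [Module ℂ M] : Type _ :=
  TwistedModule (1 : Aut V) M

namespace TwistedModule

variable {V : Type*} [AddCommGroup V] [Module ℂ V] [VertexAlgebra V] {g : Aut V}
  {M : Type*} [AddCommGroup M] [Module ℂ M]

/-- A subspace of `M` is a submodule if it is stable under all modes `v_n`. -/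
def IsSubmodule (Y : TwistedModule g M) (N : Submodule ℂ M) : Prop :=
  ∀ (n : ℚ) (v : V), ∀ w ∈ N, Y.mode n v w ∈ N

/-- `M` is irreducible if it is nonzero and has no submodules besides `0` and itself. -/
def IsIrreducible (Y : TwistedModule g M) : Prop :=
  Nontrivial M ∧ ∀ N : Submodule ℂ M, Y.IsSubmodule N → N = ⊥ ∨ N = ⊤

/-- Two `g`-twisted modules are isomorphic if there is a linear isomorphism between them that
commutes with all modes. -/
def IsIsomorphic {M' : Type*} [AddCommGroup M'] [Module ℂ M']
    (Y : TwistedModule g M) (Y' : TwistedModule g M') : Prop :=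
  ∃ f : M ≃ₗ[ℂ] M', ∀ (n : ℚ) (v : V) (w : M), f (Y.mode n v w) = Y'.mode n v (f w)

theorem smul_mem_eigenspace {h : Aut V} (hc : Commute h g) {r : ℕ} {u : V}
    (hu : u ∈ eigenspace g r) : h • u ∈ eigenspace g r := by
  change g • (h • u) = _
  rw [← mul_smul, ← hc.eq, mul_smul, show g • u = _ from hu]
  exact map_smul (h : V ≃ₗ[ℂ] V) _ u

/-- The `g`-twisted module `M·h`, for an automorphism `h` that commutes with `g`: the same space `M`,
with `Y_{M·h}(v,z) = Y_M(hv,z)`. -/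
def twist (Y : TwistedModule g M) (h : Aut V) (hc : Commute h g) : TwistedModule g M where
  isOfFinOrder := Y.isOfFinOrder
  mode n := (Y.mode n).comp ((h : V ≃ₗ[ℂ] V) : V →ₗ[ℂ] V)
  mode_eq_zero r hr u hu n hn := Y.mode_eq_zero r hr (h • u) (smul_mem_eigenspace hc hu) n hn
  truncation u w := Y.truncation (h • u) w
  vac_mode n w := by
    change Y.mode n (h • vac) w = _
    rw [Aut.smul_vac, Y.vac_mode]
  jacobi r hr u hu v w l m n hm := by
    have key := Y.jacobi r hr (h • u) (smul_mem_eigenspace hc hu) (h • v) w l m n hm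
    simp only [← Aut.smul_mode] at key
    exact key

/-- For `g ∈ G`, a `g`-twisted `V`-module restricts to a `V^G`-module. -/
def restrict (Y : TwistedModule g M) (G : Subgroup (Aut V)) (hg : g ∈ G) :
    VModule (fixedPoints G) M where
  isOfFinOrder := IsOfFinOrder.one
  mode n := (Y.mode n).comp (fixedPoints G).subtype
  mode_eq_zero r hr u _ n hn := by
    have hr0 : r = 0 := by simpa using hr
    subst hr0
    refine Y.mode_eq_zero 0 Y.isOfFinOrder.orderOf_pos u ?_ n ?_
    · change g • (u : V) = _
      simpa using u.2 g hg
    · simpa using hn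
  truncation u w := Y.truncation u w
  vac_mode n w := Y.vac_mode n w
  jacobi r hr u _ v w l m n hm := by
    have hr0 : r = 0 := by simpa using hr
    subst hr0
    refine Y.jacobi 0 Y.isOfFinOrder.orderOf_pos u ?_ v w l m n ?_
    · change g • (u : V) = _
      simpa using u.2 g hg
    · simpa using hm

theorem commute_of_mem_center {G : Subgroup (Aut V)} {σ : G} (hσ : σ ∈ Subgroup.center G) (h : G) :
    Commute (h : Aut V) (σ : Aut V) :=
  congrArg Subtype.val (Subgroup.mem_center_iff.1 hσ h)

/-- The stabilizer `G_M = {h ∈ G | M·h ≅ M}` of a `σ`-twisted module `M`, where `σ` is a central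
element of `G`. -/
def stabilizer {G : Subgroup (Aut V)} {σ : G} (hσ : σ ∈ Subgroup.center G)
    (Y : TwistedModule (σ : Aut V) M) : Set G :=
  {h | (Y.twist (h : Aut V) (commute_of_mem_center hσ h)).IsIsomorphic Y}

end TwistedModule

end VertexAlgebra

/-! Let $f : M\cdot h \to M$ be an isomorphism, with $M$ irreducible over $V^G$. Since $h$ fixes
$V^G$ pointwise, $f$ commutes with $V^G$, so it is a scalar by Schur's lemma in countable dimension
(`exists_eq_smul`). Then $Y_M(hv,z)=Y_M(v,z)$ for all $v$. As $V$ is simple, $Y_M$ is injective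
(`annihilator_eq_bot`), so $h=1$.

Conversely, a trivial stabilizer makes the twists $M\cdot h$ pairwise non-isomorphic irreducibles.
For $0\ne w$ in a $V^G$-submodule $N$, the diagonal vector $(w,\dots,w)$ therefore generates all of
$\bigoplus_h M\cdot h$ (`eq_top_of_forall_ne_zero`). By weak associativity the submodule it
generates is just the span of the vectors $((hv)_n w)_h$. The components of such a vector add up to
$(\sum_h hv)_n w$, a mode of $V^G$ applied to $w$, hence an element of $N$. The vector with $z$ at
$h=1$ and zeros elsewhere then gives $z\in N$. -/

/-! ### Spectra in countable dimension -/

open Polynomial in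
/-- An endomorphism of a nonzero complex vector space of countable dimension has nonempty spectrum. -/
theorem spectrum_nonempty_of_rank_le_aleph0 {E : Type*} [AddCommGroup E] [Module ℂ E] [Nontrivial E]
    (hE : Module.rank ℂ E ≤ Cardinal.aleph0) (f : Module.End ℂ E) : (spectrum ℂ f).Nonempty := by
  classical
  by_contra hne
  rw [Set.not_nonempty_iff_eq_empty] at hne
  -- With empty spectrum every nonzero polynomial in `f` is invertible: by spectral mapping if it is
  -- nonconstant, trivially otherwise.
  have hinj : ∀ p : ℂ[X], p ≠ 0 → ∀ w : E, aeval f p w = 0 → w = 0 := by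
    intro p hp w hw
    have hu : IsUnit (aeval f p) := by
      rcases lt_or_ge 0 p.degree with hd | hd
      · have hs := spectrum.map_polynomial_aeval_of_degree_pos f p hd
        rw [hne, Set.image_empty] at hs
        exact spectrum.isUnit_of_zero_notMem ℂ (by rw [hs]; exact Set.notMem_empty _)
      · rw [eq_C_of_degree_le_zero hd, aeval_C]
        refine (IsUnit.mk0 _ fun h0 => hp ?_).map _
        rw [eq_C_of_degree_le_zero hd, h0, C_0]
    exact ((Module.End.isUnit_iff _).1 hu).1 (hw.trans (map_zero _).symm)
  have hsurj : ∀ (c : ℂ) (w : E), ∃ x, aeval f (X - C c) x = w := by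
    intro c w
    have hc : IsUnit (algebraMap ℂ (Module.End ℂ E) c - f) :=
      spectrum.notMem_iff.1 (by rw [hne]; exact Set.notMem_empty c)
    obtain ⟨x, hx⟩ := ((Module.End.isUnit_iff _).1 hc).2 (-w)
    refine ⟨x, ?_⟩
    simp only [map_sub, aeval_X, aeval_C]
    rw [← neg_sub, LinearMap.neg_apply, hx, neg_neg]
  obtain ⟨w, hw⟩ := exists_ne (0 : E)
  -- The vectors $x_c=(f-c)^{-1}w$ are independent and indexed by the uncountable set $\mathbb{C}$.
  choose x hx using fun c => hsurj c w
  have hli : LinearIndependent ℂ x := by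
    refine linearIndependent_iff'.2 fun s m hm i hi => ?_
    -- Clearing denominators in $\sum_i m_i (f-i)^{-1}w=0$ gives $p(f)w=0$; evaluating $p$ at $i$
    -- isolates $m_i$.
    set p : ℂ[X] := ∑ i ∈ s, C (m i) * ∏ j ∈ s.erase i, (X - C j) with hp
    have h0 : aeval f p w = 0 := by
      have h1 := congrArg (aeval f (∏ j ∈ s, (X - C j))) hm
      rw [map_zero, map_sum] at h1
      rw [← h1, hp, map_sum, LinearMap.sum_apply]
      refine Finset.sum_congr rfl fun k hk => ?_
      rw [map_smul, ← s.prod_erase_mul _ hk, map_mul, map_mul, aeval_C, Module.End.mul_apply,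
        Module.End.mul_apply, hx, Module.algebraMap_end_apply]
    have hp0 : p = 0 := by
      by_contra h
      exact hw (hinj p h w h0)
    have h2 := congrArg (eval i) hp0
    rw [hp, eval_finsetSum, Finset.sum_eq_single_of_mem i hi, eval_mul, eval_C, eval_prod,
      eval_zero, mul_eq_zero] at h2
    · refine h2.resolve_right (Finset.prod_ne_zero_iff.2 fun j hj => ?_)
      rw [eval_sub, eval_X, eval_C]
      exact sub_ne_zero.2 (Finset.ne_of_mem_erase hj).symm
    · intro k hk hki
      rw [eval_mul, eval_prod, Finset.prod_eq_zero (Finset.mem_erase.2 ⟨hki.symm, hi⟩), mul_zero]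
      simp
  have h3 := hli.cardinal_lift_le_rank
  have h4 : Cardinal.lift (Module.rank ℂ E) ≤ Cardinal.aleph0 := Cardinal.lift_le_aleph0.2 hE
  exact not_countable_complex
    (Set.countable_univ_iff.2 (Cardinal.mk_le_aleph0_iff.1 (Cardinal.lift_le_aleph0.1 (h3.trans h4))))

/-! ### Finitely supported sums -/

theorem finsum_mem_submodule {E : Type*} [AddCommGroup E] [Module ℂ E] (S : Submodule ℂ E)
    {f : ℕ → E} (h : ∀ i, f i ∈ S) : ∑ᶠ i, f i ∈ S :=
  finsum_induction (· ∈ S) S.zero_mem (fun _ _ => S.add_mem) h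

theorem support_finite_of_forall_ge {E : Type*} [Zero E] {f : ℕ → E} {K : ℕ}
    (hK : ∀ i, K ≤ i → f i = 0) : f.support.Finite :=
  (Set.finite_Iio K).subset fun i hi => by
    by_contra h
    exact hi (hK i (not_lt.1 h))

/-- Serves to extract the leading term of a Jacobi sum once the later terms are handled by
induction. -/
theorem zero_mem_of_finsum_mem {E : Type*} [AddCommGroup E] [Module ℂ E] (S : Submodule ℂ E)
    {f : ℕ → E} {K : ℕ} (hK : ∀ i, K ≤ i → f i = 0) (htail : ∀ i, f (i + 1) ∈ S)
    (hsum : ∑ᶠ i, f i ∈ S) : f 0 ∈ S := by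
  rw [finsum_eq_sum_of_support_subset (s := Finset.range (K + 1)) f, Finset.sum_range_succ'] at hsum
  · exact (S.add_mem_iff_right (S.sum_mem fun i _ => htail i)).1 hsum
  · intro i hi
    by_contra h
    refine hi (hK i ?_)
    simp at h
    omega

/-! ### Eigenvectors of an automorphism of finite order -/

namespace VertexAlgebra

variable {V : Type*} [AddCommGroup V] [Module ℂ V] [VertexAlgebra V]

theorem Aut.smul_smul_complex (g : Aut V) (c : ℂ) (v : V) : g • (c • v) = c • (g • v) :=
  map_smul (g : V ≃ₗ[ℂ] V) c v

/-- A `g`-stable subspace is spanned by its eigenvectors. -/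
theorem mem_span_eigenspace {g : Aut V} (hg : IsOfFinOrder g) (N : Submodule ℂ V)
    (hN : ∀ x ∈ N, g • x ∈ N) {a : V} (ha : a ∈ N) :
    a ∈ Submodule.span ℂ {x | x ∈ N ∧ ∃ r < orderOf g, x ∈ eigenspace g r} := by
  set T := orderOf g with hT
  have hT0 : T ≠ 0 := hg.orderOf_pos.ne'
  have hTc : (T : ℂ) ≠ 0 := Nat.cast_ne_zero.2 hT0
  set ζ : ℂ := Complex.exp (2 * Real.pi * Complex.I / T) with hζ
  have hprim : IsPrimitiveRoot ζ T := Complex.isPrimitiveRoot_exp T hT0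
  have hpow : ∀ j : ℕ, g ^ j • a ∈ N := by
    intro j
    induction j with
    | zero => simpa using ha
    | succ j ih => rw [pow_succ', mul_smul]; exact hN _ ih
  -- $T$ times the projection of `a` to the eigenspace with eigenvalue $\zeta^{-r}$.
  let p : ℕ → V := fun r => ∑ j ∈ Finset.range T, ζ ^ (r * j) • (g ^ j • a)
  have hsum : ∑ r ∈ Finset.range T, p r = (T : ℂ) • a := by
    rw [Finset.sum_comm]
    simp_rw [← Finset.sum_smul]
    rw [Finset.sum_eq_single_of_mem 0 (Finset.mem_range.2 (Nat.pos_of_ne_zero hT0))]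
    · simp
    · intro j hj hj0
      have h1 : ζ ^ j ≠ 1 := hprim.pow_ne_one_of_pos_of_lt hj0 (Finset.mem_range.1 hj)
      have h2 : ∑ r ∈ Finset.range T, ζ ^ (r * j) = 0 := by
        simp_rw [mul_comm _ j, pow_mul]
        rw [geom_sum_eq h1, ← pow_mul, mul_comm, pow_mul, hprim.pow_eq_one, one_pow, sub_self,
          zero_div]
      rw [h2, zero_smul]
  have hpeig : ∀ r, p r ∈ eigenspace g r := by
    intro r
    have hη : Complex.exp (-2 * Real.pi * Complex.I * r / orderOf g) * ζ ^ r = 1 := by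
      rw [hζ, ← Complex.exp_nat_mul, ← Complex.exp_add, ← hT]
      convert Complex.exp_zero using 2
      ring
    change g • p r = _ • p r
    let F : ℕ → V := fun j => ζ ^ (r * j) • (g ^ j • a)
    have hshift : ∑ j ∈ Finset.range T, F (j + 1) = p r := by
      have h1 := Finset.sum_range_succ F T
      rw [Finset.sum_range_succ'] at h1
      have h2 : F T = F 0 := by
        simp only [F]
        rw [mul_comm, pow_mul, hprim.pow_eq_one, hT, pow_orderOf_eq_one]
        simp
      rw [h2] at h1
      exact add_right_cancel h1
    have hstep : ∀ j, g • F j = Complex.exp (-2 * Real.pi * Complex.I * r / orderOf g) • F (j + 1) := by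
      intro j
      simp only [F]
      rw [Aut.smul_smul_complex, ← mul_smul, ← pow_succ', smul_smul]
      congr 1
      rw [mul_add, mul_one, pow_add, mul_left_comm, hη, mul_one]
    calc g • p r = ∑ j ∈ Finset.range T, g • F j := Finset.smul_sum
      _ = _ := by rw [Finset.sum_congr rfl fun j _ => hstep j, ← Finset.smul_sum, hshift]
  have hpN : ∀ r, p r ∈ N := fun r => N.sum_mem fun j _ => N.smul_mem _ (hpow j)
  have : a = (T : ℂ)⁻¹ • ∑ r ∈ Finset.range T, p r := by
    rw [hsum, smul_smul, inv_mul_cancel₀ hTc, one_smul]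
  rw [this]
  exact Submodule.smul_mem _ _ (Submodule.sum_mem _ fun r hr =>
    Submodule.subset_span ⟨hpN r, r, Finset.mem_range.1 hr, hpeig r⟩)

/-! ### Cyclic submodules and Schur's lemma -/

namespace TwistedModule

variable {g : Aut V} {M : Type*} [AddCommGroup M] [Module ℂ M]

/-- The span of all `u_n w`. -/
def cyclicSubmodule (Y : TwistedModule g M) (w : M) : Submodule ℂ M :=
  Submodule.span ℂ (Set.range fun p : ℚ × V => Y.mode p.1 p.2 w)

theorem mode_mem_cyclicSubmodule (Y : TwistedModule g M) (n : ℚ) (v : V) (w : M) :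
    Y.mode n v w ∈ Y.cyclicSubmodule w :=
  Submodule.subset_span ⟨(n, v), rfl⟩

theorem self_mem_cyclicSubmodule (Y : TwistedModule g M) (w : M) : w ∈ Y.cyclicSubmodule w := by
  have h := Y.mode_mem_cyclicSubmodule (-1) vac w
  rwa [Y.vac_mode, if_pos rfl] at h

/-- Weak associativity for an eigenvector `u`. -/
theorem mode_mode_mem_cyclicSubmodule_of_eigenspace (Y : TwistedModule g M) {r : ℕ}
    (hr : r < orderOf g) {u : V} (hu : u ∈ eigenspace g r) (v : V) (w : M) (m n : ℚ) :
    Y.mode m u (Y.mode n v w) ∈ Y.cyclicSubmodule w := by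
  by_cases hm : ∃ k : ℤ, m = (r : ℚ) / orderOf g + k
  swap
  · rw [Y.mode_eq_zero r hr u hu m hm]
    exact Submodule.zero_mem _
  obtain ⟨N, hN⟩ := Y.truncation v w
  obtain ⟨N', hN'⟩ := Y.truncation u w
  -- From index $r/T+k'$ on, all modes of `u` kill `w`.
  obtain ⟨k', hk'⟩ : ∃ k' : ℤ, N' ≤ (r : ℚ) / orderOf g + k' := by
    obtain ⟨k', hk'⟩ := exists_int_gt (N' - (r : ℚ) / orderOf g)
    exact ⟨k', by linarith⟩
  -- Downward induction on `n` from the bound `N` above which $v_n w=0$.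
  have key : ∀ (j : ℕ) (n : ℚ), N ≤ n + j → ∀ k : ℤ,
      Y.mode ((r : ℚ) / orderOf g + k) u (Y.mode n v w) ∈ Y.cyclicSubmodule w := by
    intro j
    induction j with
    | zero =>
      intro n hn k
      rw [hN n (by simpa using hn), map_zero]
      exact Submodule.zero_mem _
    | succ j ih =>
      intro n hn k
      push_cast at hn
      -- With these indices the second sum vanishes, the right side lies in the span, and the first
      -- sum is the wanted $u_{r/T+k}v_nw$ plus terms with larger `n`.
      have hJ := Y.jacobi r hr u hu v w (k - k') ((r : ℚ) / orderOf g + k') n ⟨k', rfl⟩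
      have h2 : ∀ i : ℕ, Y.mode ((r : ℚ) / orderOf g + k' + i) u w = 0 := fun i =>
        hN' _ (by have : (0 : ℚ) ≤ i := i.cast_nonneg
                  linarith)
      simp only [h2, map_zero, smul_zero, finsum_zero, sub_zero] at hJ
      have h3 := zero_mem_of_finsum_mem (Y.cyclicSubmodule w) (K := j + 1) ?_ ?_
        (hJ ▸ finsum_mem_submodule _ fun i =>
          Submodule.smul_mem _ _ (Y.mode_mem_cyclicSubmodule _ _ _))
      · simpa using h3
      · intro i hi
        have : ((j : ℚ) + 1) ≤ i := by exact_mod_cast hi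
        rw [hN _ (by linarith), map_zero, smul_zero]
      · intro i
        refine Submodule.smul_mem _ _ ?_
        have h4 := ih (n + (i + 1 : ℕ)) (by push_cast; linarith [(i.cast_nonneg : (0 : ℚ) ≤ i)])
          (k - (i + 1 : ℕ))
        have h5 : (r : ℚ) / orderOf g + k' + ((k - k' : ℤ) : ℚ) - ((i + 1 : ℕ) : ℚ)
            = (r : ℚ) / orderOf g + ((k - (i + 1 : ℕ) : ℤ) : ℚ) := by
          push_cast
          ring
        rw [h5]
        exact h4
  obtain ⟨k, rfl⟩ := hm
  obtain ⟨j, hj⟩ := exists_nat_gt (N - n)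
  exact key j n (by linarith) k

theorem isSubmodule_cyclicSubmodule (Y : TwistedModule g M) (w : M) :
    Y.IsSubmodule (Y.cyclicSubmodule w) := by
  intro m u x hx
  induction hx using Submodule.span_induction with
  | zero => rw [map_zero]; exact Submodule.zero_mem _
  | add x y _ _ hx hy => rw [map_add]; exact Submodule.add_mem _ hx hy
  | smul c x _ hx => rw [map_smul]; exact Submodule.smul_mem _ _ hx
  | mem x hx =>
    obtain ⟨⟨n, v⟩, rfl⟩ := hx
    have hu := mem_span_eigenspace Y.isOfFinOrder ⊤ (fun _ _ => Submodule.mem_top)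
      (Submodule.mem_top (x := u))
    induction hu using Submodule.span_induction with
    | zero => simp
    | add x y _ _ hx hy => rw [map_add]; exact Submodule.add_mem _ hx hy
    | smul c x _ hx => rw [map_smul]; exact Submodule.smul_mem _ _ hx
    | mem u hu =>
      obtain ⟨-, r, hr, hu⟩ := hu
      exact Y.mode_mode_mem_cyclicSubmodule_of_eigenspace hr hu v w m n

theorem IsIrreducible.cyclicSubmodule_eq_top {Y : TwistedModule g M} (hY : Y.IsIrreducible) {w : M}
    (hw : w ≠ 0) : Y.cyclicSubmodule w = ⊤ :=
  (hY.2 _ (Y.isSubmodule_cyclicSubmodule w)).resolve_left fun h =>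
    hw ((Submodule.eq_bot_iff _).1 h w (Y.self_mem_cyclicSubmodule w))

/-- `M` is spanned by the countably many $b_nw$, with $n\in\mathbb{Q}$ and $b$ in a basis of `V`. -/
theorem IsIrreducible.rank_le_aleph0 {Y : TwistedModule g M} (hY : Y.IsIrreducible)
    (hdim : Module.rank ℂ V ≤ Cardinal.aleph0) : Module.rank ℂ M ≤ Cardinal.aleph0 := by
  have := hY.1
  obtain ⟨w, hw⟩ := exists_ne (0 : M)
  let b := Module.Basis.ofVectorSpace ℂ V
  have hb : Countable (Module.Basis.ofVectorSpaceIndex ℂ V) := by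
    rw [← Cardinal.mk_le_aleph0_iff, b.mk_eq_rank'']
    exact hdim
  let S : Set M := Set.range fun p : ℚ × Module.Basis.ofVectorSpaceIndex ℂ V => Y.mode p.1 (b p.2) w
  have hS : Submodule.span ℂ S = ⊤ := by
    rw [eq_top_iff, ← hY.cyclicSubmodule_eq_top hw, cyclicSubmodule, Submodule.span_le]
    rintro _ ⟨⟨n, v⟩, rfl⟩
    change Y.mode n v w ∈ Submodule.span ℂ S
    induction b.mem_span v using Submodule.span_induction with
    | zero => simp
    | add x y _ _ hx hy => rw [map_add]; exact Submodule.add_mem _ hx hy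
    | smul c x _ hx => rw [map_smul]; exact Submodule.smul_mem _ _ hx
    | mem x hx =>
      obtain ⟨i, rfl⟩ := hx
      exact Submodule.subset_span ⟨(n, i), rfl⟩
  rw [← rank_top ℂ M, ← hS]
  exact (rank_span_le S).trans (Cardinal.mk_le_aleph0_iff.2 (Set.countable_range _).to_subtype)

/-- Schur's lemma in countable dimension. -/
theorem IsIrreducible.exists_eq_smul {Y : TwistedModule g M} (hY : Y.IsIrreducible)
    (hdim : Module.rank ℂ V ≤ Cardinal.aleph0) (f : Module.End ℂ M)
    (hf : ∀ (n : ℚ) (v : V) (w : M), f (Y.mode n v w) = Y.mode n v (f w)) :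
    ∃ c : ℂ, ∀ w, f w = c • w := by
  have := hY.1
  obtain ⟨c, hc⟩ := spectrum_nonempty_of_rank_le_aleph0 (hY.rank_le_aleph0 hdim) f
  let d : Module.End ℂ M := algebraMap ℂ (Module.End ℂ M) c - f
  have hd : ∀ w, d w = c • w - f w := fun w => by simp [d]
  have hcomm : ∀ (n : ℚ) (v : V) (w : M), d (Y.mode n v w) = Y.mode n v (d w) := fun n v w => by
    rw [hd, hd, hf, map_sub, map_smul]
  have hd0 : d = 0 := by
    by_contra hne
    have hker := (hY.2 (LinearMap.ker d) fun n v w hw => by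
      rw [LinearMap.mem_ker] at hw ⊢
      rw [hcomm, hw, map_zero]).resolve_right fun h => hne (LinearMap.ker_eq_top.1 h)
    have hrange := (hY.2 (LinearMap.range d) fun n v w hw => by
      obtain ⟨x, rfl⟩ := hw
      exact ⟨Y.mode n v x, hcomm n v x⟩).resolve_left fun h => hne (LinearMap.range_eq_bot.1 h)
    exact spectrum.mem_iff.1 hc ((Module.End.isUnit_iff _).2
      ⟨LinearMap.ker_eq_bot.1 hker, LinearMap.range_eq_top.1 hrange⟩)
  refine ⟨c, fun w => ?_⟩
  have h := hd w
  rw [hd0, LinearMap.zero_apply] at h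
  exact (sub_eq_zero.1 h.symm).symm

end TwistedModule

end VertexAlgebra

/-! ### The annihilator ideal and faithfulness -/

namespace VertexAlgebra

variable {V : Type*} [AddCommGroup V] [Module ℂ V] [VertexAlgebra V]

namespace TwistedModule

variable {g : Aut V} {M : Type*} [AddCommGroup M] [Module ℂ M]

/-- The vectors `v` such that `Y_M(g^j v, z) = 0` for all `j`. -/
def annihilator (Y : TwistedModule g M) : Submodule ℂ V where
  carrier := {v | ∀ (j : ℕ) (n : ℚ), Y.mode n (g ^ j • v) = 0}
  zero_mem' j n := by rw [smul_zero, map_zero]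
  add_mem' ha hb j n := by rw [smul_add, map_add, ha j n, hb j n, add_zero]
  smul_mem' c x hx j n := by rw [Aut.smul_smul_complex, map_smul, hx j n, smul_zero]

theorem mode_eq_zero_of_mem_annihilator {Y : TwistedModule g M} {v : V} (hv : v ∈ Y.annihilator)
    (n : ℚ) : Y.mode n v = 0 := by
  simpa using hv 0 n

theorem pow_smul_mem_annihilator {Y : TwistedModule g M} {v : V} (hv : v ∈ Y.annihilator) (k : ℕ) :
    g ^ k • v ∈ Y.annihilator := fun j n => by
  rw [← mul_smul, ← pow_add]
  exact hv (j + k) n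

/-- If `u` is an eigenvector and one of `u`, `v` acts as zero, then so do all `u_l v`. -/
theorem mode_mode_eq_zero_of_eigenspace (Y : TwistedModule g M) {r : ℕ} (hr : r < orderOf g) {u : V}
    (hu : u ∈ eigenspace g r) {v : V} (h : (∀ n, Y.mode n u = 0) ∨ ∀ n, Y.mode n v = 0) (l : ℤ)
    (n : ℚ) : Y.mode n (VertexAlgebra.mode l u v) = 0 := by
  obtain ⟨N, hN⟩ := VertexAlgebra.truncation u v
  have key : ∀ (j : ℕ) (l : ℤ), N ≤ l + j → ∀ (n : ℚ) (w : M),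
      Y.mode n (VertexAlgebra.mode l u v) w = 0 := by
    intro j
    induction j with
    | zero =>
      intro l hl n w
      rw [hN l (by simpa using hl), map_zero, LinearMap.zero_apply]
    | succ j ih =>
      intro l hl n w
      push_cast at hl
      -- The left side vanishes; on the right the $i=0$ term is $(u_lv)_nw$, and the others involve
      -- $u_{l+i}v$, covered by induction.
      have hJ := Y.jacobi r hr u hu v w l ((r : ℚ) / orderOf g) (n - (r : ℚ) / orderOf g)
        ⟨0, by simp⟩
      have h1 : ∀ a b : ℚ, Y.mode a u (Y.mode b v w) = 0 := fun a b => by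
        rcases h with h | h
        · rw [h, LinearMap.zero_apply]
        · rw [h b, LinearMap.zero_apply, map_zero]
      have h2 : ∀ a b : ℚ, Y.mode a v (Y.mode b u w) = 0 := fun a b => by
        rcases h with h | h
        · rw [h b, LinearMap.zero_apply, map_zero]
        · rw [h, LinearMap.zero_apply]
      simp only [h1, h2, smul_zero, finsum_zero, sub_zero] at hJ
      have h3 := zero_mem_of_finsum_mem (⊥ : Submodule ℂ M) (K := j + 1) ?_ ?_
        ((Submodule.mem_bot ℂ).2 hJ.symm)
      · simpa using h3
      · intro i hi
        rw [hN _ (by omega), map_zero, LinearMap.zero_apply, smul_zero]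
      · intro i
        rw [Submodule.mem_bot, ih _ (by push_cast; omega), smul_zero]
  exact LinearMap.ext fun w => key (N - l).toNat l (by have := Int.self_le_toNat (N - l); omega) n w

theorem mode_mode_eq_zero (Y : TwistedModule g M) {u a : V} (ha : a ∈ Y.annihilator) (l : ℤ) (n : ℚ) :
    Y.mode n (VertexAlgebra.mode l u a) = 0 ∧ Y.mode n (VertexAlgebra.mode l a u) = 0 := by
  constructor
  · have hu := mem_span_eigenspace Y.isOfFinOrder ⊤ (fun _ _ => Submodule.mem_top)
      (Submodule.mem_top (x := u))
    induction hu using Submodule.span_induction with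
    | zero => simp
    | add x y _ _ hx hy => rw [map_add, LinearMap.add_apply, map_add, hx, hy, add_zero]
    | smul c x _ hx => rw [map_smul, LinearMap.smul_apply, map_smul, hx, smul_zero]
    | mem u hu =>
      obtain ⟨-, r, hr, hu⟩ := hu
      exact Y.mode_mode_eq_zero_of_eigenspace hr hu
        (Or.inr (mode_eq_zero_of_mem_annihilator ha)) l n
  -- The Jacobi identity needs its first argument to be an eigenvector. The powers of `g` in
  -- `annihilator` make it `g`-stable, hence spanned by eigenvectors.
  · have hspan := mem_span_eigenspace Y.isOfFinOrder Y.annihilator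
      (fun x hx => by simpa using pow_smul_mem_annihilator hx 1) ha
    clear ha
    induction hspan using Submodule.span_induction with
    | zero => simp
    | add x y _ _ hx hy => rw [map_add, LinearMap.add_apply, map_add, hx, hy, add_zero]
    | smul c x _ hx => rw [map_smul, LinearMap.smul_apply, map_smul, hx, smul_zero]
    | mem a ha =>
      obtain ⟨ha, r, hr, har⟩ := ha
      exact Y.mode_mode_eq_zero_of_eigenspace hr har
        (Or.inl (mode_eq_zero_of_mem_annihilator ha)) l n

theorem _root_.VertexAlgebra.Aut.pow_smul_mode (g : Aut V) (j : ℕ) (u v : V) (n : ℤ) :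
    g ^ j • VertexAlgebra.mode n u v = VertexAlgebra.mode n (g ^ j • u) (g ^ j • v) :=
  Aut.smul_mode (g ^ j) u v n

theorem isIdeal_annihilator (Y : TwistedModule g M) : IsIdeal Y.annihilator := by
  intro u l a ha
  constructor
  · intro j n
    rw [Aut.pow_smul_mode]
    exact (Y.mode_mode_eq_zero (pow_smul_mem_annihilator ha j) l n).1
  · intro j n
    rw [Aut.pow_smul_mode]
    exact (Y.mode_mode_eq_zero (pow_smul_mem_annihilator ha j) l n).2

theorem annihilator_eq_bot (hV : IsSimple V) [Nontrivial M] (Y : TwistedModule g M) :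
    Y.annihilator = ⊥ := by
  refine (hV.2 _ Y.isIdeal_annihilator).resolve_right fun h => ?_
  obtain ⟨w, hw⟩ := exists_ne (0 : M)
  have h1 : (vac : V) ∈ Y.annihilator := h ▸ Submodule.mem_top
  have h2 := Y.vac_mode (-1) w
  rw [mode_eq_zero_of_mem_annihilator h1, if_pos rfl] at h2
  exact hw h2.symm

/-- An automorphism commuting with `g` that does not change `Y_M` is trivial. -/
theorem eq_one_of_mode_smul_eq (hV : IsSimple V) [Nontrivial M] (Y : TwistedModule g M) {h : Aut V}
    (hc : Commute h g) (hh : ∀ (n : ℚ) (v : V), Y.mode n (h • v) = Y.mode n v) : h = 1 := by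
  have key : ∀ v : V, h • v = v := fun v => by
    rw [← sub_eq_zero, ← Submodule.mem_bot ℂ, ← Y.annihilator_eq_bot hV]
    intro j n
    rw [smul_sub, ← mul_smul, ← (hc.pow_right j).eq, mul_smul, map_sub, hh, sub_self]
  exact Subtype.ext (LinearEquiv.ext key)

/-! ### Direct sums of non-isomorphic irreducibles -/

section Pi

variable {ι : Type*} [Finite ι]

theorem _root_.finsum_apply_of_forall_ge {ι E : Type*} [AddCommGroup E] {f : ℕ → ι → E} {K : ℕ}
    (hK : ∀ i, K ≤ i → f i = 0) (a : ι) : (∑ᶠ i, f i) a = ∑ᶠ i, f i a :=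
  (Pi.evalAddMonoidHom (fun _ : ι => E) a).map_finsum (support_finite_of_forall_ge hK)

theorem exists_forall_ge_mode_eq_zero (Y : ι → TwistedModule g M) (u : V) (w : ι → M) :
    ∃ N : ℚ, ∀ n : ℚ, N ≤ n → ∀ h, (Y h).mode n u (w h) = 0 := by
  choose N hN using fun h => (Y h).truncation u (w h)
  obtain ⟨B, hB⟩ := (Set.finite_range N).bddAbove
  exact ⟨B, fun n hn h => hN h n ((hB ⟨h, rfl⟩).trans hn)⟩

/-- The direct sum of finitely many twisted modules. -/
def pi [Nonempty ι] (Y : ι → TwistedModule g M) : TwistedModule g (ι → M) where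
  isOfFinOrder := (Y (Classical.arbitrary ι)).isOfFinOrder
  mode n := LinearMap.mk₂ ℂ (fun v w h => (Y h).mode n v (w h))
    (fun _ _ _ => funext fun _ => by simp) (fun _ _ _ => funext fun _ => by simp)
    (fun _ _ _ => funext fun _ => by simp) (fun _ _ _ => funext fun _ => by simp)
  mode_eq_zero r hr u hu n hn := LinearMap.ext fun w => funext fun h => by
    simp [(Y h).mode_eq_zero r hr u hu n hn]
  truncation u w := by
    obtain ⟨N, hN⟩ := exists_forall_ge_mode_eq_zero Y u w
    exact ⟨N, fun n hn => funext fun h => hN n hn h⟩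
  vac_mode n w := funext fun h => by
    simp only [LinearMap.mk₂_apply, (Y h).vac_mode]
    split_ifs <;> rfl
  jacobi r hr u hu v w l m n hm := by
    have htrunc : ∀ (v : V) (n : ℚ), ∃ K : ℕ, ∀ i : ℕ, K ≤ i → ∀ h, (Y h).mode (n + i) v (w h) = 0 := by
      intro v n
      obtain ⟨N, hN⟩ := exists_forall_ge_mode_eq_zero Y v w
      obtain ⟨K, hK⟩ := exists_nat_ge (N - n)
      exact ⟨K, fun i hi => hN _ (by have : (K : ℚ) ≤ i := by exact_mod_cast hi
                                     linarith)⟩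
    obtain ⟨K₁, hK₁⟩ := htrunc v n
    obtain ⟨K₂, hK₂⟩ := htrunc u m
    obtain ⟨N, hN⟩ := VertexAlgebra.truncation u v
    funext h
    rw [Pi.sub_apply, finsum_apply_of_forall_ge (K := K₁), finsum_apply_of_forall_ge (K := K₂),
      finsum_apply_of_forall_ge (K := (N - l).toNat)]
    · exact (Y h).jacobi r hr u hu v (w h) l m n hm
    · intro i hi
      funext h
      simp [hN (l + i) (by omega)]
    · intro i hi
      funext h
      simp [hK₂ i hi h]
    · intro i hi
      funext h
      simp [hK₁ i hi h]

theorem pi_mode_apply [Nonempty ι] (Y : ι → TwistedModule g M) (n : ℚ) (v : V) (w : ι → M) (h : ι) :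
    (pi Y).mode n v w h = (Y h).mode n v (w h) := rfl

/-- A submodule of a direct sum of pairwise non-isomorphic irreducible modules that has a vector
with no zero component is everything. -/
theorem eq_top_of_forall_ne_zero [Nonempty ι] {Y : ι → TwistedModule g M}
    (hY : ∀ h, (Y h).IsIrreducible) (hne : ∀ s h, (Y s).IsIsomorphic (Y h) → s = h)
    {W : Submodule ℂ (ι → M)} (hW : (pi Y).IsSubmodule W) {x : ι → M} (hx : x ∈ W)
    (hx0 : ∀ h, x h ≠ 0) : W = ⊤ := by
  classical
  have := Fintype.ofFinite ι
  -- `K S` consists of the vectors of `W` that vanish on `S`.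
  let K : Finset ι → Submodule ℂ (ι → M) := fun S =>
    W ⊓ ⨅ s ∈ S, LinearMap.ker (LinearMap.proj (R := ℂ) (φ := fun _ : ι => M) s)
  have hKmem : ∀ S y, y ∈ K S ↔ y ∈ W ∧ ∀ s ∈ S, y s = 0 := fun S y => by
    simp [K, Submodule.mem_iInf]
  have hKsub : ∀ S, (pi Y).IsSubmodule (K S) := fun S n v y hy => by
    rw [hKmem] at hy ⊢
    exact ⟨hW n v y hy.1, fun s hs => by rw [pi_mode_apply, hy.2 s hs, map_zero]⟩
  have hproj : ∀ (P : Submodule ℂ (ι → M)), (pi Y).IsSubmodule P → ∀ h,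
      (∀ y ∈ P, y h = 0) ∨ ∀ z, ∃ y ∈ P, y h = z := by
    intro P hP h
    rcases (hY h).2 (P.map (LinearMap.proj h)) (by
      rintro n v _ ⟨y, hy, rfl⟩
      exact ⟨_, hP n v y hy, rfl⟩) with h0 | h1
    · exact Or.inl fun y hy => (Submodule.eq_bot_iff _).1 h0 _ ⟨y, hy, rfl⟩
    · refine Or.inr fun z => ?_
      obtain ⟨y, hy, hyz⟩ := (Submodule.eq_top_iff'.1 h1 z)
      exact ⟨y, hy, hyz⟩
  have key : ∀ S : Finset ι, ∀ h ∉ S, ∀ z, ∃ y ∈ K S, y h = z := by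
    intro S
    induction S using Finset.induction_on with
    | empty =>
      intro h _
      exact (hproj _ (hKsub ∅) h).resolve_left fun h0 =>
        hx0 h (h0 x ((hKmem _ _).2 ⟨hx, by simp⟩))
    | insert s S hs ih =>
      intro h hh
      rw [Finset.mem_insert, not_or] at hh
      -- If `K (insert s S)` had zero projection to `h`, then the `s` and `h` components on `K S`
      -- would determine each other, and `K S` would project to the graph of an isomorphism from `Y
      -- s` to `Y h`.
      refine (hproj _ (hKsub _) h).resolve_left fun h0 => hh.1 (hne s h ?_).symm
      have hsh : ∀ y ∈ K S, y s = 0 → y h = 0 := fun y hy hys => h0 y (by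
        rw [hKmem] at hy ⊢
        exact ⟨hy.1, Finset.forall_mem_insert _ _ _ |>.2 ⟨hys, hy.2⟩⟩)
      have hsub : (pi Y).IsSubmodule (K S ⊓ LinearMap.ker (LinearMap.proj h)) := fun n v y hy => by
        refine ⟨hKsub S n v y hy.1, ?_⟩
        have h1 : y h = 0 := hy.2
        change (Y h).mode n v (y h) = 0
        rw [h1, map_zero]
      have hhs : ∀ y ∈ K S, y h = 0 → y s = 0 := fun y hy hyh => by
        refine (hproj _ hsub s).elim (fun h1 => h1 y ⟨hy, hyh⟩) fun h1 => ?_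
        exfalso
        -- `a - b` vanishes at `s`, hence at `h`, where its value is `x h ≠ 0`.
        obtain ⟨a, ha, hah⟩ := ih h hh.2 (x h)
        obtain ⟨b, hb, hbs⟩ := h1 (a s)
        have h2 := hsh (a - b) (Submodule.sub_mem _ ha hb.1) (by rw [Pi.sub_apply, hbs, sub_self])
        have hbh : b h = 0 := hb.2
        rw [Pi.sub_apply, hbh, sub_zero, hah] at h2
        exact hx0 h h2
      let ps : K S →ₗ[ℂ] M := (LinearMap.proj s).comp (K S).subtype
      let ph : K S →ₗ[ℂ] M := (LinearMap.proj h).comp (K S).subtype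
      have hps : Function.Surjective ps := fun z => by
        obtain ⟨y, hy, hyz⟩ := ih s hs z
        exact ⟨⟨y, hy⟩, hyz⟩
      have hph : Function.Surjective ph := fun z => by
        obtain ⟨y, hy, hyz⟩ := ih h hh.2 z
        exact ⟨⟨y, hy⟩, hyz⟩
      have hker : LinearMap.ker ps = LinearMap.ker ph := by
        ext y
        exact ⟨fun hy => hsh y y.2 hy, fun hy => hhs y y.2 hy⟩
      let f : M ≃ₗ[ℂ] M := (ps.quotKerEquivOfSurjective hps).symm ≪≫ₗ
        Submodule.quotEquivOfEq _ _ hker ≪≫ₗ ph.quotKerEquivOfSurjective hph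
      have hf : ∀ y : K S, f (ps y) = ph y := fun y => by
        have h1 : (ps.quotKerEquivOfSurjective hps).symm (ps y) = Submodule.Quotient.mk y := by
          rw [LinearEquiv.symm_apply_eq]
          rfl
        simp only [f, LinearEquiv.trans_apply, h1]
        rfl
      refine ⟨f, fun n v w => ?_⟩
      obtain ⟨y, rfl⟩ := hps w
      rw [hf]
      exact hf ⟨(pi Y).mode n v y, hKsub S n v y y.2⟩
  rw [Submodule.eq_top_iff']
  intro z
  have hz : z = ∑ h, Pi.single h (z h) := (Finset.univ_sum_single z).symm
  rw [hz]
  refine W.sum_mem fun h _ => ?_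
  -- Elements of `K (univ.erase h)` are supported at `h`.
  obtain ⟨y, hy, hyz⟩ := key (Finset.univ.erase h) h (Finset.notMem_erase _ _) (z h)
  rw [hKmem] at hy
  have hys : y = Pi.single h (z h) := by
    funext s
    by_cases hsh : s = h
    · subst hsh
      rw [hyz, Pi.single_eq_same]
    · rw [Pi.single_eq_of_ne hsh]
      exact hy.2 s (by simp [hsh])
  exact hys ▸ hy.1

end Pi

/-! ### Twists and the two implications -/

theorem twist_mode (Y : TwistedModule g M) (h : Aut V) (hc : Commute h g) (n : ℚ) (v : V) :
    (Y.twist h hc).mode n v = Y.mode n (h • v) := rfl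

theorem IsIrreducible.twist {Y : TwistedModule g M} (hY : Y.IsIrreducible) (h : Aut V)
    (hc : Commute h g) : (Y.twist h hc).IsIrreducible :=
  ⟨hY.1, fun N hN => hY.2 N fun n v w hw => by
    have := hN n (h⁻¹ • v) w hw
    rwa [twist_mode, smul_inv_smul] at this⟩

variable {G : Subgroup (Aut V)} {σ : G}

theorem one_mem_stabilizer (hσ : σ ∈ Subgroup.center G) (Y : TwistedModule (σ : Aut V) M) :
    (1 : G) ∈ Y.stabilizer hσ :=
  ⟨LinearEquiv.refl ℂ M, fun n v w => by
    rw [twist_mode]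
    simp⟩

theorem stabilizer_subset_of_isIrreducible_restrict (hV : IsSimple V)
    (hdim : Module.rank ℂ V ≤ Cardinal.aleph0) (hσ : σ ∈ Subgroup.center G)
    (Y : TwistedModule (σ : Aut V) M) (hR : (Y.restrict G σ.2).IsIrreducible) :
    Y.stabilizer hσ ⊆ {1} := by
  rintro h ⟨f, hf⟩
  have := hR.1
  have hdim' : Module.rank ℂ (fixedPoints G) ≤ Cardinal.aleph0 := (Submodule.rank_le _).trans hdim
  obtain ⟨c, hc⟩ := hR.exists_eq_smul hdim' (f : M →ₗ[ℂ] M) fun n v w => by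
    have h1 := hf n v w
    rw [twist_mode, v.2 h h.2] at h1
    exact h1
  have hc' : ∀ w, f w = c • w := hc
  have hc0 : c ≠ 0 := by
    rintro rfl
    obtain ⟨w, hw⟩ := exists_ne (0 : M)
    exact hw (f.injective (by rw [hc', zero_smul, map_zero]))
  refine Subtype.ext (Y.eq_one_of_mode_smul_eq hV (commute_of_mem_center hσ h) fun n v => ?_)
  refine LinearMap.ext fun w => ?_
  have h1 := hf n v w
  rw [twist_mode, hc', hc', (Y.mode n v).map_smul] at h1
  exact smul_right_injective M hc0 h1

/-- Adding components turns $v_n$ on the diagonal into the mode of the orbit sum $\sum_h hv\in V^G$,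
which preserves `N`. -/
theorem finsum_mem_of_mem_cyclicSubmodule_pi [Finite G] (hσ : σ ∈ Subgroup.center G)
    (Y : TwistedModule (σ : Aut V) M) {N : Submodule ℂ M} (hN : (Y.restrict G σ.2).IsSubmodule N)
    {w : M} (hw : w ∈ N) {x : G → M}
    (hx : x ∈ (pi fun h : G => Y.twist h (commute_of_mem_center hσ h)).cyclicSubmodule fun _ => w) :
    ∑ᶠ h, x h ∈ N := by
  have := Fintype.ofFinite G
  rw [finsum_eq_sum_of_fintype]
  induction hx using Submodule.span_induction with
  | zero => simp
  | add x y _ _ hx hy =>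
    simp only [Pi.add_apply, Finset.sum_add_distrib]
    exact N.add_mem hx hy
  | smul c x _ hx =>
    simp only [Pi.smul_apply, ← Finset.smul_sum]
    exact N.smul_mem c hx
  | mem x hx =>
    obtain ⟨⟨n, v⟩, rfl⟩ := hx
    have hfix : ∑ h : G, (h : Aut V) • v ∈ fixedPoints G := fun k hk => by
      rw [Finset.smul_sum]
      simp_rw [← mul_smul]
      exact Fintype.sum_equiv (Equiv.mulLeft (⟨k, hk⟩ : G)) _ _ fun h => rfl
    have h1 := hN n ⟨_, hfix⟩ w hw
    change Y.mode n (∑ h : G, (h : Aut V) • v) w ∈ N at h1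
    rw [map_sum, LinearMap.sum_apply] at h1
    exact h1

theorem isIrreducible_restrict_of_stabilizer_eq [Finite G] (hσ : σ ∈ Subgroup.center G)
    {Y : TwistedModule (σ : Aut V) M} (hY : Y.IsIrreducible) (hs : Y.stabilizer hσ = {1}) :
    (Y.restrict G σ.2).IsIrreducible := by
  refine ⟨hY.1, fun N hN => or_iff_not_imp_left.2 fun hbot => ?_⟩
  obtain ⟨w, hw, hw0⟩ := Submodule.exists_mem_ne_zero_of_ne_bot hbot
  let Z : G → TwistedModule (σ : Aut V) M := fun h => Y.twist h (commute_of_mem_center hσ h)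
  have hne : ∀ s h, (Z s).IsIsomorphic (Z h) → s = h := by
    rintro s h ⟨f, hf⟩
    -- Replacing $v$ by $h^{-1}v$ turns $M\cdot s\cong M\cdot h$ into $M\cdot(sh^{-1})\cong M$.
    have h1 : s * h⁻¹ ∈ Y.stabilizer hσ := ⟨f, fun n v w => by
      have h2 := hf n ((h : Aut V)⁻¹ • v) w
      simp only [Z, twist_mode, smul_inv_smul] at h2
      rw [twist_mode, ← h2, ← mul_smul]
      rfl⟩
    rw [hs, Set.mem_singleton_iff] at h1
    exact mul_inv_eq_one.1 h1
  have htop := eq_top_of_forall_ne_zero (fun h : G => hY.twist h (commute_of_mem_center hσ h)) hne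
    ((pi Z).isSubmodule_cyclicSubmodule fun _ => w) ((pi Z).self_mem_cyclicSubmodule fun _ => w)
    fun _ => hw0
  rw [Submodule.eq_top_iff']
  intro z
  classical
  have h1 := finsum_mem_of_mem_cyclicSubmodule_pi hσ Y hN hw
    (x := Pi.single 1 z) (Submodule.eq_top_iff'.1 htop _)
  have := Fintype.ofFinite G
  rwa [finsum_eq_sum_of_fintype, Finset.sum_pi_single', if_pos (Finset.mem_univ _)] at h1

end TwistedModule

end VertexAlgebra

theorem corollary7 {V : Type*} [AddCommGroup V] [Module ℂ V] [VertexAlgebra V]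
    (hV : VertexAlgebra.IsSimple V) (hdim : Module.rank ℂ V ≤ Cardinal.aleph0)
    (G : Subgroup (VertexAlgebra.Aut V)) [Finite G]
    (σ : G) (hσ : σ ∈ Subgroup.center G)
    {M : Type*} [AddCommGroup M] [Module ℂ M]
    (Y : VertexAlgebra.TwistedModule (σ : VertexAlgebra.Aut V) M) (hM : Y.IsIrreducible) :
    (Y.restrict G σ.2).IsIrreducible ↔ Y.stabilizer hσ = {1} :=
  ⟨fun h => (Y.stabilizer_subset_of_isIrreducible_restrict hV hdim hσ h).antisymm
      (Set.singleton_subset_iff.2 (Y.one_mem_stabilizer hσ)),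
    VertexAlgebra.TwistedModule.isIrreducible_restrict_of_stabilizer_eq hσ hM⟩
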